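/- For real $\rho>0$ and complex $\mu,z$ let $$E_{\rho,\mu}(z)=\sum_{k=0}^{\infty}\frac{z^k}{\Gamma(\mu+k/\rho)}$$ be the Mittag-Leffler function (with $1/\Gamma=0$ at the poles of $\Gamma$). For complex $z\neq0$ let $\arg z\in[0,2\pi)$; powers of $zr$ and of $zre^{-i\pi}$, $r>0$, are taken with the arguments $\arg z$ and $\arg z-\pi$ respectively, i.e. $(zr)^a=\exp\{a(\ln(|z|r)+i\arg z)\}$ and $(zre^{-i\pi})^a=\exp\{a(\ln(|z|r)+i(\arg z-\pi))\}$. Put $$\eta(r,\varphi,z)=(zr)^{\rho}e^{-i\rho\pi}\sin(\rho\varphi)+\rho(1-\mu)\varphi,\qquad \chi(r,\varphi,z)=(zr)^\rho\sin(\rho\varphi)+\rho(1-\mu)\varphi,$$ $$P_{\rho,\mu}(r,\varphi,z)=\frac{\rho}{2\pi}\,\frac{\exp\{(zr)^\rho\cos(\rho\varphi)\}\,(zr)^{\rho(1-\mu)}e^{i\chi(r,\varphi,z)}\,r\,[r-e^{i\varphi}]}{r^2-2r\cos\varphi+1},$$ $$A_{\rho,\mu}(r,\omega_1,\omega_2,z)=\exp\{(zr)^\rho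 e^{-i\rho\pi}\cos(\rho\omega_1)\}\,(r^2+2r\cos\omega_2+1)\,e^{i\eta(r,\omega_1,z)}\,[r+e^{i\omega_1}],$$ $$K_{\rho,\mu}(r,\varphi_1,\varphi_2,z)=\frac{\rho}{2\pi i}\,\frac{(zr)^{\rho(1-\mu)}e^{-i\rho\pi(1-\mu)}\,[A_{\rho,\mu}(r,\varphi_2,\varphi_1,z)-A_{\rho,\mu}(r,\varphi_1,\varphi_2,z)]}{(r^2+2r\cos\varphi_1+1)(r^2+2r\cos\varphi_2+1)},$$ $$K_{\rho,\mu}(r,\varphi,z)=\frac{\rho}{\pi}(zre^{-i\pi})^{\rho(1-\mu)}\exp\{(zre^{-i\pi})^\rho\cos(\rho\varphi)\}\,\frac{r\sin(\eta(r,\varphi,z))+\sin(\eta(r,\varphi,z)+\varphi)}{r^2+2r\cos\varphi+1},$$ $$K_{\rho,\mu}(r,z)=\frac{\rho}{\pi}(zre^{-i\pi})^{\rho(1-\mu)}\exp\{-(zre^{-i\pi})^\rho\}\,\frac{r\sin(\pi(1-\mu))+\sin(\pi(1-\mu)+\pi/\rho)}{r^2+2r\cos(\pi/\rho)+1}.$$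 Let $\epsilon>0$ be real and $\mu$ complex. Then the following holds, where the series and all the integrals converge absolutely. 1. For all real $\rho>1/2$, all real $\delta_\rho$ with $\frac{\pi}{2\rho}<\delta_\rho\le\min(\pi,\frac{\pi}{\rho})$ and all complex $z\ne0$ with $\frac{\pi}{2\rho}-\delta_\rho+\pi<\arg z<-\frac{\pi}{2\rho}+\delta_\rho+\pi$, $$E_{\rho,\mu}(z)=\int_{1+\epsilon}^{\infty}K_{\rho,\mu}(r,\delta_\rho,z)\,dr+\int_{-\delta_\rho-\pi}^{\delta_\rho-\pi}P_{\rho,\mu}(1+\epsilon,\varphi,z)\,d\varphi,$$ and $K_{\rho,\mu}(r,-\delta_\rho,\delta_\rho,z)=K_{\rho,\mu}(r,\delta_\rho,z)$ for all $r\ge1+\epsilon$. 2. For all real $\rho\ge1$ and all complex $z\ne0$ with $-\frac{\pi}{2\rho}+\pi<\arg z<\frac{\pi}{2\rho}+\pi$, $$E_{\rho,\mu}(z)=\int_{1+\epsilon}^{\infty}K_{\rho,\mu}(r,z)\,dr+\int_{-\frac{\pi}{\rho}-\pi}^{\frac{\pi}{\rho}-\pi}P_{\rho,\mu}(1+\epsilon,\varphi,z)\,d\varphi,$$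 and $K_{\rho,\mu}(r,\pi/\rho,z)=K_{\rho,\mu}(r,z)$ for all $r\ge1+\epsilon$. -/

import Mathlib

namespace MittagLefflerRep

/-- The two-parameter Mittag-Leffler function `∑ z ^ k / Γ(μ + k / ρ)`.
Mathlib sets `Γ = 0` at the poles of `Γ` and `w / 0 = 0`, so that `1 / Γ = 0` there, as usual. -/
noncomputable def mittagLeffler (ρ : ℝ) (μ z : ℂ) : ℂ :=
  ∑' k : ℕ, z ^ k / Complex.Gamma (μ + k / ρ)

/-- The argument of `z ≠ 0` with values in `[0, 2π)` (plane cut along the positive real axis). -/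
noncomputable def argCut (z : ℂ) : ℝ :=
  if 0 ≤ Complex.arg z then Complex.arg z else Complex.arg z + 2 * Real.pi

/-- The power `w ^ a` of the point `w = R * exp (i θ)`, `R > 0`, taken with the argument `θ`. -/
noncomputable def polarPow (R θ : ℝ) (a : ℂ) : ℂ :=
  Complex.exp (a * ((Real.log R : ℂ) + (θ : ℂ) * Complex.I))

/-- `(z r) ^ a` for `r > 0`, with `arg (z r) = arg z`. -/
noncomputable def zrPow (r : ℝ) (z a : ℂ) : ℂ :=
  polarPow (‖z‖ * r) (argCut z) a

/-- `(z r e^{-iπ}) ^ a` for `r > 0`, with `arg (z r e^{-iπ}) = arg z - π`. -/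
noncomputable def zrRotPow (r : ℝ) (z a : ℂ) : ℂ :=
  polarPow (‖z‖ * r) (argCut z - Real.pi) a

/-- `η(r, φ, z)`. -/
noncomputable def eta (ρ : ℝ) (μ : ℂ) (r φ : ℝ) (z : ℂ) : ℂ :=
  zrPow r z ρ * Complex.exp (-(Complex.I * ρ * Real.pi)) * Complex.sin (ρ * φ)
    + ρ * (1 - μ) * φ

/-- `χ(r, φ, z)`. -/
noncomputable def chi (ρ : ℝ) (μ : ℂ) (r φ : ℝ) (z : ℂ) : ℂ :=
  zrPow r z ρ * Complex.sin (ρ * φ) + ρ * (1 - μ) * φ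

/-- The arc integrand `P_{ρ,μ}(r, φ, z)`. -/
noncomputable def arcKernel (ρ : ℝ) (μ : ℂ) (r φ : ℝ) (z : ℂ) : ℂ :=
  ρ / (2 * Real.pi) *
    (Complex.exp (zrPow r z ρ * Complex.cos (ρ * φ)) * zrPow r z (ρ * (1 - μ)) *
        Complex.exp (Complex.I * chi ρ μ r φ z) * r * (r - Complex.exp (Complex.I * φ)) /
      (r ^ 2 - 2 * r * Complex.cos φ + 1))

/-- `A_{ρ,μ}(r, ω₁, ω₂, z)`. -/
noncomputable def rayTerm (ρ : ℝ) (μ : ℂ) (r ω₁ ω₂ : ℝ) (z : ℂ) : ℂ :=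
  Complex.exp (zrPow r z ρ * Complex.exp (-(Complex.I * ρ * Real.pi)) * Complex.cos (ρ * ω₁)) *
    (r ^ 2 + 2 * r * Complex.cos ω₂ + 1) * Complex.exp (Complex.I * eta ρ μ r ω₁ z) *
    (r + Complex.exp (Complex.I * ω₁))

/-- The general ray kernel `K_{ρ,μ}(r, φ₁, φ₂, z)` of the two rays of the contour. -/
noncomputable def rayKernelGen (ρ : ℝ) (μ : ℂ) (r φ₁ φ₂ : ℝ) (z : ℂ) : ℂ :=
  ρ / (2 * Real.pi * Complex.I) *
    (zrPow r z (ρ * (1 - μ)) * Complex.exp (-(Complex.I * ρ * Real.pi * (1 - μ))) *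
        (rayTerm ρ μ r φ₂ φ₁ z - rayTerm ρ μ r φ₁ φ₂ z) /
      ((r ^ 2 + 2 * r * Complex.cos φ₁ + 1) * (r ^ 2 + 2 * r * Complex.cos φ₂ + 1)))

/-- The symmetric ray kernel `K_{ρ,μ}(r, φ, z)`. -/
noncomputable def rayKernel (ρ : ℝ) (μ : ℂ) (r φ : ℝ) (z : ℂ) : ℂ :=
  ρ / Real.pi * zrRotPow r z (ρ * (1 - μ)) *
    Complex.exp (zrRotPow r z ρ * Complex.cos (ρ * φ)) *
    ((r * Complex.sin (eta ρ μ r φ z) + Complex.sin (eta ρ μ r φ z + φ)) /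
      (r ^ 2 + 2 * r * Complex.cos φ + 1))

/-- The ray kernel `K_{ρ,μ}(r, z)` of the angle `π / ρ`. -/
noncomputable def rayKernelPi (ρ : ℝ) (μ : ℂ) (r : ℝ) (z : ℂ) : ℂ :=
  ρ / Real.pi * zrRotPow r z (ρ * (1 - μ)) *
    Complex.exp (-zrRotPow r z ρ) *
    ((r * Complex.sin (Real.pi * (1 - μ)) + Complex.sin (Real.pi * (1 - μ) + Real.pi / ρ)) /
      (r ^ 2 + 2 * r * Complex.cos (Real.pi / ρ) + 1))

end MittagLefflerRep

namespace MittagLefflerRep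

open Set Filter Topology MeasureTheory

/-! Hankel's formula writes `2πi / Γ(s)` as the integral of `e^u u^{-s}` over a contour coming from
and returning to infinity in the left half plane. With `u = e^w` the branch of `u^{-s}` disappears:
the integrand becomes the entire function `hankelKernel s w`, and the contour two horizontal rays
joined by a vertical segment. The rays may lie at any heights in the strips where `cos` is negative
around `-π` and `π`, and the abscissa `R` of the segment is arbitrary (`hankelIntegral_eq`).

For `s = μ + k / ρ` the index `k` enters only through the factor `e^{-kw/ρ}`, so the Mittag-Leffler
series becomes a geometric series of ratio `z e^{-w/ρ}` under the integral. For `R = ρ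
log(|z|(1+ε))` the ratio has modulus at most `1/(1+ε)` on the whole contour, and summation and
integration commute (`hasSum_pow_mul_hankelIntegral`).

In the coordinates `w = ρ log(|z| r) + iρ(arg z + φ)` the segment gives the arc integral
(`arcKernel_eq`) and the two rays combine into the ray kernel (`rayKernelGen_eq`). The condition on
`arg z` places both rays in the admissible strips. -/

/-- The integrand of Hankel's formula for `1 / Γ(s)` in the logarithmic coordinate `w = log u`. -/
noncomputable def hankelKernel (s w : ℂ) : ℂ :=
  Complex.exp (Complex.exp w + (1 - s) * w)

/-! ### Decay of the Hankel kernel and deformation of the contour. -/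

theorem norm_hankelKernel (s : ℂ) (t y : ℝ) :
    ‖hankelKernel s (t + y * Complex.I)‖ =
      Real.exp (Real.exp t * Real.cos y + ((1 - s.re) * t + s.im * y)) := by
  rw [hankelKernel, Complex.norm_exp]
  congr 1
  simp [Complex.exp_re]

theorem differentiable_hankelKernel (s : ℂ) : Differentiable ℂ (hankelKernel s) := by
  unfold hankelKernel; fun_prop

theorem continuous_hankelKernel (s : ℂ) : Continuous (hankelKernel s) :=
  (differentiable_hankelKernel s).continuous

/-- Bounding `exp t` below by `t ^ 2 / 2` and completing the square; the spare `-t` supplies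
exponential decay. -/
theorem neg_mul_exp_add_mul_le {c : ℝ} (hc : 0 < c) (a : ℝ) {t : ℝ} (ht : 0 ≤ t) :
    -c * Real.exp t + a * t ≤ (a + 1) ^ 2 / (2 * c) - t := by
  have h1 : t ^ 2 / 2 ≤ Real.exp t := by
    have := Real.quadratic_le_exp_of_nonneg ht
    linarith
  have h2 : c * (t ^ 2 / 2) ≤ c * Real.exp t := by gcongr
  have h3 : (a + 1) * t - c * (t ^ 2 / 2) ≤ (a + 1) ^ 2 / (2 * c) := by
    rw [le_div_iff₀ (by positivity)]
    nlinarith [sq_nonneg (c * t - (a + 1))]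
  linarith

/-- By compactness the maximum of `cos` on the segment is still negative, so one constant serves all
heights. This uniformity makes the far vertical side of a rectangle negligible. -/
theorem exists_norm_hankelKernel_le (s : ℂ) {a b : ℝ} (h : ∀ y ∈ uIcc a b, Real.cos y < 0) :
    ∃ C : ℝ, ∀ t : ℝ, 0 ≤ t → ∀ y ∈ uIcc a b,
      ‖hankelKernel s (t + y * Complex.I)‖ ≤ C * Real.exp (-t) := by
  obtain ⟨y₀, hy₀, hmax⟩ := isCompact_uIcc.exists_isMaxOn nonempty_uIcc
    (Real.continuous_cos.continuousOn (s := uIcc a b))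
  obtain ⟨y₁, -, hmax'⟩ := isCompact_uIcc.exists_isMaxOn nonempty_uIcc
    ((continuous_const.mul continuous_id).continuousOn (f := fun y : ℝ => s.im * y)
      (s := uIcc a b))
  refine ⟨Real.exp ((1 - s.re + 1) ^ 2 / (2 * -Real.cos y₀) + s.im * y₁), fun t ht y hy => ?_⟩
  rw [norm_hankelKernel, ← Real.exp_add]
  refine Real.exp_le_exp.2 ?_
  have h1 : Real.cos y ≤ Real.cos y₀ := hmax hy
  have h2 : s.im * y ≤ s.im * y₁ := hmax' hy
  have h3 := neg_mul_exp_add_mul_le (neg_pos.2 (h y₀ hy₀)) (1 - s.re) ht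
  have h4 := mul_le_mul_of_nonneg_left h1 (Real.exp_pos t).le
  linarith

theorem integrableOn_hankelKernel (s : ℂ) (R : ℝ) {y : ℝ} (h : Real.cos y < 0) :
    IntegrableOn (fun t : ℝ => hankelKernel s (t + y * Complex.I)) (Ioi R) := by
  obtain ⟨C, hC⟩ := exists_norm_hankelKernel_le s (a := y) (b := y) (by simpa using h)
  have hc : Continuous fun t : ℝ => hankelKernel s (t + y * Complex.I) :=
    (continuous_hankelKernel s).comp (by fun_prop)
  rw [IntegrableOn, ← integrable_norm_iff hc.aestronglyMeasurable]
  refine integrable_of_isBigO_exp_neg one_pos hc.norm.continuousOn ?_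
  refine Asymptotics.IsBigO.of_bound C ?_
  filter_upwards [eventually_ge_atTop 0] with t ht
  simpa using hC t ht y (by simp)

theorem tendsto_hankelKernel_ray (s : ℂ) {y : ℝ} (h : Real.cos y < 0) :
    Tendsto (fun t : ℝ => hankelKernel s (t + y * Complex.I)) atTop (𝓝 0) := by
  obtain ⟨C, hC⟩ := exists_norm_hankelKernel_le s (a := y) (b := y) (by simpa using h)
  refine squeeze_zero_norm' (a := fun t => C * Real.exp (-t)) ?_ ?_
  · filter_upwards [eventually_ge_atTop 0] with t ht using hC t ht y (by simp)
  · simpa using (Real.tendsto_exp_neg_atTop_nhds_zero).const_mul C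

theorem hankelKernel_rect (s : ℂ) (R T a b : ℝ) :
    (∫ t in R..T, hankelKernel s (t + a * Complex.I)) -
      (∫ t in R..T, hankelKernel s (t + b * Complex.I)) +
      Complex.I * (∫ y in a..b, hankelKernel s (T + y * Complex.I)) -
      Complex.I * (∫ y in a..b, hankelKernel s (R + y * Complex.I)) = 0 := by
  have := Complex.integral_boundary_rect_eq_zero_of_differentiableOn (hankelKernel s)
    (R + a * Complex.I) (T + b * Complex.I) (differentiable_hankelKernel s).differentiableOn
  simpa using this

/-- Moving a ray of the contour vertically. -/
theorem hankelKernel_shift_ray (s : ℂ) (R : ℝ) {a b : ℝ}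
    (h : ∀ y ∈ uIcc a b, Real.cos y < 0) :
    (∫ t in Ioi R, hankelKernel s (t + b * Complex.I)) +
      Complex.I * (∫ y in a..b, hankelKernel s (R + y * Complex.I)) =
      ∫ t in Ioi R, hankelKernel s (t + a * Complex.I) := by
  have ha := intervalIntegral_tendsto_integral_Ioi R
    (integrableOn_hankelKernel s R (h a left_mem_uIcc)) tendsto_id
  have hb := intervalIntegral_tendsto_integral_Ioi R
    (integrableOn_hankelKernel s R (h b right_mem_uIcc)) tendsto_id
  -- The far side of the rectangle has fixed length and a uniformly decaying integrand.
  have htop : Tendsto (fun T : ℝ => ∫ y in a..b, hankelKernel s (T + y * Complex.I)) atTop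
      (𝓝 0) := by
    obtain ⟨C, hC⟩ := exists_norm_hankelKernel_le s h
    refine squeeze_zero_norm' (a := fun t => C * Real.exp (-t) * |b - a|) ?_ ?_
    · filter_upwards [eventually_ge_atTop 0] with t ht
      exact intervalIntegral.norm_integral_le_of_norm_le_const
        fun y hy => hC t ht y (uIoc_subset_uIcc hy)
    · simpa using ((Real.tendsto_exp_neg_atTop_nhds_zero).const_mul C).mul_const |b - a|
  have hlim := ((ha.sub hb).add (htop.const_mul Complex.I)).sub
    (tendsto_const_nhds
      (x := Complex.I * (∫ y in a..b, hankelKernel s (R + y * Complex.I))))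
  simp only [id, hankelKernel_rect] at hlim
  have := tendsto_nhds_unique hlim tendsto_const_nhds
  linear_combination -this

/-- The integral of the Hankel kernel along the contour
`∞ + i a → R + i a → R + i b → ∞ + i b`. -/
noncomputable def hankelIntegral (s : ℂ) (R a b : ℝ) : ℂ :=
  (∫ t in Ioi R, hankelKernel s (t + b * Complex.I)) +
    Complex.I * (∫ y in a..b, hankelKernel s (R + y * Complex.I)) -
    ∫ t in Ioi R, hankelKernel s (t + a * Complex.I)

theorem intervalIntegrable_hankelKernel (s : ℂ) (R a b : ℝ) :
    IntervalIntegrable (fun y : ℝ => hankelKernel s (R + y * Complex.I)) volume a b :=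
  ((continuous_hankelKernel s).comp (by fun_prop)).intervalIntegrable _ _

theorem hankelIntegral_shift_angles (s : ℂ) (R : ℝ) {a a' b b' : ℝ}
    (ha : ∀ y ∈ uIcc a a', Real.cos y < 0) (hb : ∀ y ∈ uIcc b b', Real.cos y < 0) :
    hankelIntegral s R a b = hankelIntegral s R a' b' := by
  have h1 := hankelKernel_shift_ray s R ha
  have h2 := hankelKernel_shift_ray s R hb
  have h3 := intervalIntegral.integral_add_adjacent_intervals
    (intervalIntegrable_hankelKernel s R a a') (intervalIntegrable_hankelKernel s R a' b')
  have h4 := intervalIntegral.integral_add_adjacent_intervals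
    (intervalIntegrable_hankelKernel s R a b) (intervalIntegrable_hankelKernel s R b b')
  unfold hankelIntegral
  linear_combination h1 - h2 + Complex.I * (h4 - h3)

/-- Cauchy's theorem on a bounded rectangle; negativity of `cos` is needed only on the two rays, for
convergence, and not at the heights in between. -/
theorem hankelIntegral_shift_base (s : ℂ) (R R' : ℝ) {a b : ℝ}
    (ha : Real.cos a < 0) (hb : Real.cos b < 0) :
    hankelIntegral s R a b = hankelIntegral s R' a b := by
  have split : ∀ {y : ℝ}, Real.cos y < 0 →
      (∫ t in R..R', hankelKernel s (t + y * Complex.I)) +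
        (∫ t in Ioi R', hankelKernel s (t + y * Complex.I)) =
        ∫ t in Ioi R, hankelKernel s (t + y * Complex.I) := fun hy =>
    intervalIntegral.integral_interval_add_Ioi (integrableOn_hankelKernel s R hy)
      (integrableOn_hankelKernel s R' hy)
  have h1 := split ha
  have h2 := split hb
  have h3 := hankelKernel_rect s R R' a b
  unfold hankelIntegral
  linear_combination h1 - h2 - h3

/-- Integration by parts along the contour. -/
theorem mul_hankelIntegral_add_one (s : ℂ) (R : ℝ) {a b : ℝ}
    (ha : Real.cos a < 0) (hb : Real.cos b < 0) :
    s * hankelIntegral (s + 1) R a b = hankelIntegral s R a b := by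
  -- Multiplying the kernel of `s + 1` by `e^w` gives the kernel of `s`. Integrating this derivative
  -- along the three pieces, the corner values cancel and the ends at infinity vanish.
  have hd : ∀ w : ℂ, HasDerivAt (hankelKernel (s + 1))
      (hankelKernel s w - s * hankelKernel (s + 1) w) w := by
    intro w
    have h := ((Complex.hasDerivAt_exp w).add
      ((hasDerivAt_id w).const_mul (1 - (s + 1)))).cexp
    have e : hankelKernel s w = hankelKernel (s + 1) w * Complex.exp w := by
      rw [hankelKernel, hankelKernel, ← Complex.exp_add]; congr 1; ring
    rw [e]
    refine h.congr_deriv ?_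
    simp only [hankelKernel, Pi.add_apply, id]
    ring
  have hray : ∀ {y : ℝ}, Real.cos y < 0 →
      (∫ t in Ioi R, hankelKernel s (t + y * Complex.I)) -
        s * (∫ t in Ioi R, hankelKernel (s + 1) (t + y * Complex.I)) =
        - hankelKernel (s + 1) (R + y * Complex.I) := by
    intro y hy
    have i1 := integrableOn_hankelKernel s R hy
    have i2 := (integrableOn_hankelKernel (s + 1) R hy).const_mul s
    rw [← integral_const_mul, ← integral_sub i1 i2]
    have := integral_Ioi_of_hasDerivAt_of_tendsto' (a := R)
      (f := fun t : ℝ => hankelKernel (s + 1) (t + y * Complex.I))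
      (fun t _ => ?_) (i1.sub i2) (tendsto_hankelKernel_ray (s + 1) hy)
    · simpa using this
    · have h := (hd (t + y * Complex.I)).comp t
        ((Complex.ofRealCLM.hasDerivAt (x := t)).add_const (y * Complex.I))
      refine h.congr_deriv ?_
      simp
  have hvert : Complex.I * (∫ y in a..b, hankelKernel s (R + y * Complex.I)) -
        s * (Complex.I * (∫ y in a..b, hankelKernel (s + 1) (R + y * Complex.I))) =
        hankelKernel (s + 1) (R + b * Complex.I) - hankelKernel (s + 1) (R + a * Complex.I) := by
    have i1 := (intervalIntegrable_hankelKernel s R a b).const_mul Complex.I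
    have i2 := ((intervalIntegrable_hankelKernel (s + 1) R a b).const_mul Complex.I).const_mul s
    rw [← intervalIntegral.integral_const_mul, ← intervalIntegral.integral_const_mul,
      ← intervalIntegral.integral_const_mul, ← intervalIntegral.integral_sub i1 i2]
    refine intervalIntegral.integral_eq_sub_of_hasDerivAt
      (f := fun y : ℝ => hankelKernel (s + 1) (R + y * Complex.I)) (fun y _ => ?_) (i1.sub i2)
    have h := (hd (R + y * Complex.I)).comp y
      (((Complex.ofRealCLM.hasDerivAt (x := y)).mul_const Complex.I).const_add (R : ℂ))
    refine h.congr_deriv ?_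
    simp
    ring
  have h1 := hray ha
  have h2 := hray hb
  unfold hankelIntegral
  linear_combination h1 - h2 - hvert

/-! ### Evaluation of the contour integral: Hankel's formula. -/

theorem norm_hankelKernel_le_of_nonpos {s : ℂ} (hs : s.re ≤ 1) {R y : ℝ} (hR : R ≤ 0)
    (hy : |y| ≤ Real.pi) :
    ‖hankelKernel s (R + y * Complex.I)‖ ≤ Real.exp (1 + |s.im| * Real.pi) := by
  rw [norm_hankelKernel]
  refine Real.exp_le_exp.2 ?_
  have h1 : Real.exp R * Real.cos y ≤ 1 := by
    have := Real.exp_le_one_iff.2 hR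
    nlinarith [Real.cos_le_one y, Real.exp_pos R]
  have h2 : (1 - s.re) * R ≤ 0 := mul_nonpos_of_nonneg_of_nonpos (by linarith) hR
  have h3 : s.im * y ≤ |s.im| * Real.pi := by
    refine (le_abs_self _).trans ?_
    rw [abs_mul]
    gcongr
  linarith

/-- Dominated convergence as the segment recedes to the left; `re s ≤ 1` keeps `e^{(1-s)R}` bounded.
The limit `c` is `1` for `s = 1` and `0` for `re s < 1`. -/
theorem tendsto_integral_hankelKernel_atBot {s : ℂ} (hs : s.re ≤ 1) {c : ℂ}
    (h : ∀ y : ℝ, Tendsto (fun R : ℝ => hankelKernel s (R + y * Complex.I)) atBot (𝓝 c)) :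
    Tendsto (fun R : ℝ => ∫ y in (-Real.pi)..Real.pi, hankelKernel s (R + y * Complex.I)) atBot
      (𝓝 (2 * Real.pi * c)) := by
  have := intervalIntegral.tendsto_integral_filter_of_dominated_convergence
    (μ := volume) (a := -Real.pi) (b := Real.pi) (l := atBot)
    (F := fun R y : ℝ => hankelKernel s (R + y * Complex.I)) (f := fun _ => c)
    (fun _ => Real.exp (1 + |s.im| * Real.pi)) ?_ ?_ (by simp) ?_
  · convert this using 2
    rw [intervalIntegral.integral_const, Complex.real_smul]
    push_cast
    ring
  · exact Eventually.of_forall fun R =>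
      ((continuous_hankelKernel s).comp (by fun_prop)).aestronglyMeasurable
  · filter_upwards [eventually_le_atBot 0] with R hR
    refine ae_of_all _ fun y hy => norm_hankelKernel_le_of_nonpos hs hR ?_
    rw [uIoc_of_le (by linarith [Real.pi_pos])] at hy
    exact abs_le.2 ⟨hy.1.le, hy.2⟩
  · exact ae_of_all _ fun y _ => h y

/-- At `s = 1` the kernel is `2πi`-periodic, so the rays at `±π` cancel and only the segment
contributes. This value has to be found separately, since the recurrence from `s = 0` only says `0 =
0`. -/
theorem hankelIntegral_one (R : ℝ) :
    hankelIntegral 1 R (-Real.pi) Real.pi = 2 * Real.pi * Complex.I := by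
  have hval : ∀ R : ℝ, hankelIntegral 1 R (-Real.pi) Real.pi =
      Complex.I * ∫ y in (-Real.pi)..Real.pi, hankelKernel 1 (R + y * Complex.I) := by
    intro R
    have : ∀ t : ℝ, hankelKernel 1 (t + (Real.pi : ℝ) * Complex.I) =
        hankelKernel 1 (t + (-Real.pi : ℝ) * Complex.I) := by
      intro t
      simp [hankelKernel, Complex.exp_add, Complex.exp_neg]
    simp only [hankelIntegral, this]
    ring
  have hlim := (tendsto_integral_hankelKernel_atBot (s := 1) (by simp) (c := 1) ?_).const_mul
    Complex.I
  · simp only [← hval] at hlim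
    have hc : (fun R' => hankelIntegral 1 R' (-Real.pi) Real.pi) =
        fun _ => hankelIntegral 1 R (-Real.pi) Real.pi := by
      funext R'
      exact hankelIntegral_shift_base 1 R' R (by simp) (by simp)
    rw [hc] at hlim
    rw [tendsto_nhds_unique tendsto_const_nhds hlim]
    ring
  · intro y
    have h0 : Tendsto (fun R : ℝ => Complex.exp (R + y * Complex.I)) atBot (𝓝 0) := by
      rw [tendsto_zero_iff_norm_tendsto_zero]
      simpa [Complex.norm_exp] using Real.tendsto_exp_atBot
    simpa [hankelKernel] using h0.cexp

theorem integral_exp_neg_exp_Ioi (s : ℂ) (R : ℝ) :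
    ∫ t in Ioi R, Complex.exp (-Complex.exp t + (1 - s) * t) =
      ∫ x in Ioi (Real.exp R), ((Real.exp (-x) : ℝ) : ℂ) * (x : ℂ) ^ ((1 - s) - 1) := by
  rw [← integral_comp_exp_Ioi]
  refine integral_congr_ae (ae_of_all _ fun t => ?_)
  have hne : ((Real.exp t : ℝ) : ℂ) ≠ 0 := by exact_mod_cast (Real.exp_pos t).ne'
  simp only [Complex.real_smul]
  rw [Complex.cpow_def_of_ne_zero hne, ← Complex.ofReal_log (Real.exp_pos t).le, Real.log_exp]
  push_cast
  rw [← Complex.exp_add, ← Complex.exp_add]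
  congr 1
  ring

/-- As `R → -∞` the segment vanishes and the rays tend to `e^{±iπ(1-s)} Γ(1-s)`; their difference is
turned into `1 / Γ(s)` by the reflection formula. -/
theorem hankelIntegral_of_re_lt_one {s : ℂ} (hs : s.re < 1) (R : ℝ) :
    hankelIntegral s R (-Real.pi) Real.pi = 2 * Real.pi * Complex.I / Complex.Gamma s := by
  have hray : ∀ σ : ℝ, Real.cos σ = -1 → Real.sin σ = 0 → ∀ R : ℝ,
      ∫ t in Ioi R, hankelKernel s (t + σ * Complex.I) =
        Complex.exp ((1 - s) * (σ * Complex.I)) *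
        ∫ x in Ioi (Real.exp R), ((Real.exp (-x) : ℝ) : ℂ) * (x : ℂ) ^ ((1 - s) - 1) := by
    intro σ hσ hσ' R
    rw [← integral_exp_neg_exp_Ioi, ← integral_const_mul]
    refine integral_congr_ae (ae_of_all _ fun t => ?_)
    have : Complex.exp (σ * Complex.I) = -1 := by
      rw [Complex.exp_mul_I, ← Complex.ofReal_cos, ← Complex.ofReal_sin, hσ, hσ']; simp
    simp only [hankelKernel]
    rw [Complex.exp_add t, this, ← Complex.exp_add]
    congr 1
    ring
  have hG : Tendsto (fun R : ℝ => ∫ x in Ioi (Real.exp R),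
      ((Real.exp (-x) : ℝ) : ℂ) * (x : ℂ) ^ ((1 - s) - 1)) atBot
      (𝓝 (Complex.Gamma (1 - s))) := by
    have hre : 0 < (1 - s).re := by simpa using hs
    have hint := Complex.GammaIntegral_convergent hre
    rw [Complex.Gamma_eq_integral hre, Complex.GammaIntegral]
    have hU := (aecover_Ioi_of_Ioi (μ := volume) (A := (0 : ℝ)) (l := atBot) (a := Real.exp)
      Real.tendsto_exp_atBot).integral_tendsto_of_countably_generated hint
    refine hU.congr fun R => ?_
    rw [Measure.restrict_restrict measurableSet_Ioi,
      inter_eq_left.2 (Ioi_subset_Ioi (Real.exp_pos R).le)]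
  have hvert := tendsto_integral_hankelKernel_atBot hs.le (c := 0) (fun y => by
    rw [tendsto_zero_iff_norm_tendsto_zero]
    simp only [norm_hankelKernel]
    refine Real.tendsto_exp_atBot.comp ?_
    have h1 : Tendsto (fun t : ℝ => Real.exp t * Real.cos y) atBot (𝓝 (0 * Real.cos y)) :=
      Real.tendsto_exp_atBot.mul_const _
    exact h1.add_atBot (tendsto_atBot_add_const_right _ _
      (tendsto_id.const_mul_atBot (by linarith))))
  have hlim := ((hG.const_mul (Complex.exp ((1 - s) * ((Real.pi : ℝ) * Complex.I)))).add
    (hvert.const_mul Complex.I)).sub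
    (hG.const_mul (Complex.exp ((1 - s) * ((-Real.pi : ℝ) * Complex.I))))
  simp only [← hray Real.pi (by simp) (by simp), ← hray (-Real.pi) (by simp) (by simp)] at hlim
  -- Independence of the base abscissa turns the limit into the value at `R`.
  have hc : ∀ R' : ℝ, hankelIntegral s R' (-Real.pi) Real.pi =
      hankelIntegral s R (-Real.pi) Real.pi := fun R' =>
    hankelIntegral_shift_base s R' R (by simp) (by simp)
  simp only [hankelIntegral] at hc
  simp only [hc] at hlim
  rw [hankelIntegral, tendsto_nhds_unique tendsto_const_nhds hlim]
  have hsin : Complex.exp ((1 - s) * ((Real.pi : ℝ) * Complex.I)) -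
      Complex.exp ((1 - s) * ((-Real.pi : ℝ) * Complex.I)) =
      2 * Complex.I * Complex.sin (Real.pi * (1 - s)) := by
    rw [Complex.sin]
    have e1 : (1 - s) * ((Real.pi : ℝ) * Complex.I) = Real.pi * (1 - s) * Complex.I := by ring
    have e2 : (1 - s) * ((-Real.pi : ℝ) * Complex.I) = -(Real.pi * (1 - s)) * Complex.I := by
      push_cast; ring
    rw [e1, e2]
    linear_combination (Complex.exp (Real.pi * (1 - s) * Complex.I) -
      Complex.exp (-(Real.pi * (1 - s)) * Complex.I)) * Complex.I_sq
  have hrefl := Complex.Gamma_mul_Gamma_one_sub (1 - s)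
  rw [sub_sub_cancel] at hrefl
  have hne : Complex.Gamma (1 - s) ≠ 0 :=
    Complex.Gamma_ne_zero_of_re_pos (by simpa using hs)
  have key : Complex.Gamma (1 - s) * Complex.sin (Real.pi * (1 - s)) =
      Real.pi / Complex.Gamma s := by
    -- Only `Γ(1-s) ≠ 0` is used, so the poles of `Γ(s)`, where both sides are `0`, need no separate
    -- case.
    have h2 : (Complex.Gamma s)⁻¹ =
        Complex.Gamma (1 - s) * Complex.sin (Real.pi * (1 - s)) / Real.pi := by
      rw [eq_div_iff (by exact_mod_cast Real.pi_ne_zero), ← inv_inj, mul_inv, inv_inv, mul_inv,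
        ← div_eq_mul_inv, div_eq_iff (by exact_mod_cast Real.pi_ne_zero)]
      have := congrArg (fun x => (Complex.Gamma (1 - s))⁻¹ * x) hrefl
      simp only [inv_mul_cancel_left₀ hne] at this
      rw [this]
      ring
    rw [div_eq_mul_inv, h2]
    field_simp [Real.pi_ne_zero]
  linear_combination Complex.Gamma (1 - s) * hsin + 2 * Complex.I * key

/-- **Hankel's formula** for the reciprocal of the Gamma function. -/
theorem hankelIntegral_pi (s : ℂ) (R : ℝ) :
    hankelIntegral s R (-Real.pi) Real.pi = 2 * Real.pi * Complex.I / Complex.Gamma s := by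
  obtain ⟨n, hn⟩ := exists_nat_gt s.re
  induction n generalizing s with
  | zero => exact hankelIntegral_of_re_lt_one (by push_cast at hn; linarith) R
  | succ n ih =>
    -- The induction lowers `re s` by one through the recurrence, which requires dividing by `s -
    -- 1`.
    by_cases h : s = 1
    · simp [h, hankelIntegral_one]
    · have hne : s - 1 ≠ 0 := sub_ne_zero.2 h
      have h1 := mul_hankelIntegral_add_one (s - 1) R (a := -Real.pi) (b := Real.pi)
        (by simp) (by simp)
      have h2 := Complex.Gamma_add_one (s - 1) hne
      rw [sub_add_cancel] at h1 h2
      rw [ih (s - 1) (by simp; push_cast at hn; linarith)] at h1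
      rw [h2, mul_comm (s - 1), ← div_div, eq_div_iff hne, mul_comm, h1]

/-- Each interval is a component of `{cos < 0}`, so a ray can be moved to height `±π` without
leaving the region of decay. -/
theorem hankelIntegral_eq (s : ℂ) (R : ℝ) {a b : ℝ}
    (ha : a ∈ Ioo (-(3 * Real.pi / 2)) (-(Real.pi / 2)))
    (hb : b ∈ Ioo (Real.pi / 2) (3 * Real.pi / 2)) :
    hankelIntegral s R a b = 2 * Real.pi * Complex.I / Complex.Gamma s := by
  have hcos : ∀ y ∈ Ioo (Real.pi / 2) (3 * Real.pi / 2), Real.cos y < 0 := fun y hy =>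
    Real.cos_neg_of_pi_div_two_lt_of_lt hy.1 (by linarith [hy.2])
  have hpi := Real.pi_pos
  rw [← hankelIntegral_pi s R]
  refine hankelIntegral_shift_angles s R (fun y hy => ?_) (fun y hy => hcos y ?_)
  · have := (ordConnected_Ioo.uIcc_subset ha
      (show -Real.pi ∈ Ioo (-(3 * Real.pi / 2)) (-(Real.pi / 2)) by
        constructor <;> linarith)) hy
    rw [← Real.cos_neg]
    exact hcos _ ⟨by linarith [this.2], by linarith [this.1]⟩
  · exact (ordConnected_Ioo.uIcc_subset hb
      (show Real.pi ∈ Ioo (Real.pi / 2) (3 * Real.pi / 2) by constructor <;> linarith)) hy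

/-! ### Summation of the geometric series under the integral. -/

theorem one_sub_ne_zero_of_norm_lt_one {u : ℂ} (hu : ‖u‖ < 1) : 1 - u ≠ 0 := by
  intro h
  rw [← sub_eq_zero.1 h] at hu
  simp at hu

theorem integrable_div_one_sub {α : Type*} [MeasurableSpace α] {ν : Measure α} {f u : α → ℂ}
    {q : ℝ} (hf : Integrable f ν) (hu : AEStronglyMeasurable u ν) (hq : q < 1)
    (huq : ∀ᵐ x ∂ν, ‖u x‖ ≤ q) : Integrable (fun x => f x / (1 - u x)) ν := by
  have hm : AEStronglyMeasurable (fun x => (1 - u x)⁻¹) ν :=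
    (aestronglyMeasurable_const.sub hu).aemeasurable.inv.aestronglyMeasurable
  simp only [div_eq_mul_inv]
  refine hf.mul_bdd (c := (1 - q)⁻¹) hm ?_
  filter_upwards [huq] with x hx
  rw [norm_inv]
  have h1 : 1 - q ≤ ‖1 - u x‖ := by
    have := norm_sub_norm_le 1 (u x)
    rw [norm_one] at this
    linarith
  exact inv_anti₀ (by linarith) h1

/-- Dominated convergence with the geometric majorant `q ^ k * ‖f‖`. -/
theorem hasSum_integral_pow_mul {α : Type*} [MeasurableSpace α] {ν : Measure α} {f u : α → ℂ}
    {q : ℝ} (hf : Integrable f ν) (hu : AEStronglyMeasurable u ν) (hq0 : 0 ≤ q) (hq : q < 1)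
    (huq : ∀ᵐ x ∂ν, ‖u x‖ ≤ q) :
    HasSum (fun k : ℕ => ∫ x, u x ^ k * f x ∂ν) (∫ x, f x / (1 - u x) ∂ν) := by
  refine hasSum_integral_of_dominated_convergence (fun k x => q ^ k * ‖f x‖)
    (fun k => (hu.pow k).mul hf.aestronglyMeasurable) (fun k => huq.mono fun x hx => ?_)
    (ae_of_all _ fun x => (summable_geometric_of_lt_one hq0 hq).mul_right _) ?_
    (huq.mono fun x hx => ?_)
  · rw [norm_mul, norm_pow]
    gcongr
  · simp only [tsum_mul_right]
    exact hf.norm.const_mul _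
  · have := (hasSum_geometric_of_norm_lt_one (hx.trans_lt hq)).mul_right (f x)
    rwa [inv_mul_eq_div] at this

/-- The sum over `k` of `z ^ k` times the Hankel kernels of `1 / Γ(μ + k / ρ)`. -/
noncomputable def summedKernel (ρ : ℝ) (μ z w : ℂ) : ℂ :=
  hankelKernel μ w / (1 - z * Complex.exp (-w / ρ))

theorem pow_mul_hankelKernel (ρ : ℝ) (μ z w : ℂ) (k : ℕ) :
    z ^ k * hankelKernel (μ + k / ρ) w =
      (z * Complex.exp (-w / ρ)) ^ k * hankelKernel μ w := by
  rw [mul_pow, mul_assoc, ← Complex.exp_nat_mul, hankelKernel, hankelKernel, ← Complex.exp_add]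
  congr 2
  ring

theorem norm_mul_exp_neg_div (ρ : ℝ) (z : ℂ) (t y : ℝ) :
    ‖z * Complex.exp (-(t + y * Complex.I) / ρ)‖ = ‖z‖ * Real.exp (-t / ρ) := by
  rw [norm_mul, Complex.norm_exp, Complex.div_ofReal_re]
  simp

/-- The modulus of the ratio depends only on `re w` and decreases in it, so the bound on the segment
governs the rays too. -/
theorem norm_mul_exp_neg_div_le {ρ R t : ℝ} (hρ : 0 < ρ) (z : ℂ) (ht : R ≤ t) (y : ℝ) :
    ‖z * Complex.exp (-(t + y * Complex.I) / ρ)‖ ≤ ‖z‖ * Real.exp (-R / ρ) := by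
  rw [norm_mul_exp_neg_div]
  gcongr

theorem integrableOn_summedKernel_ray {ρ R y : ℝ} (hρ : 0 < ρ) (μ : ℂ) {z : ℂ}
    (hz : ‖z‖ * Real.exp (-R / ρ) < 1) (hy : Real.cos y < 0) :
    IntegrableOn (fun t : ℝ => summedKernel ρ μ z (t + y * Complex.I)) (Ioi R) :=
  integrable_div_one_sub (integrableOn_hankelKernel μ R hy)
    (Continuous.aestronglyMeasurable (by fun_prop)) hz <| by
      filter_upwards [ae_restrict_mem measurableSet_Ioi] with t ht
      exact norm_mul_exp_neg_div_le hρ z (le_of_lt ht) y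

theorem continuous_summedKernel_vertical {ρ R : ℝ} (hρ : 0 < ρ) (μ : ℂ) {z : ℂ}
    (hz : ‖z‖ * Real.exp (-R / ρ) < 1) :
    Continuous fun y : ℝ => summedKernel ρ μ z (R + y * Complex.I) := by
  refine Continuous.div ((continuous_hankelKernel μ).comp (by fun_prop)) (by fun_prop)
    fun y => one_sub_ne_zero_of_norm_lt_one ?_
  exact (norm_mul_exp_neg_div_le hρ z le_rfl y).trans_lt hz

theorem hasSum_pow_mul_hankelIntegral {ρ R a b : ℝ} (hρ : 0 < ρ) (μ : ℂ) {z : ℂ}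
    (hz : ‖z‖ * Real.exp (-R / ρ) < 1) (hab : a ≤ b) (ha : Real.cos a < 0)
    (hb : Real.cos b < 0) :
    HasSum (fun k : ℕ => z ^ k * hankelIntegral (μ + k / ρ) R a b)
      ((∫ t in Ioi R, summedKernel ρ μ z (t + b * Complex.I)) +
        Complex.I * (∫ y in a..b, summedKernel ρ μ z (R + y * Complex.I)) -
        ∫ t in Ioi R, summedKernel ρ μ z (t + a * Complex.I)) := by
  have hq0 : 0 ≤ ‖z‖ * Real.exp (-R / ρ) := by positivity
  have hray : ∀ y : ℝ, Real.cos y < 0 →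
      HasSum (fun k : ℕ => z ^ k * ∫ t in Ioi R, hankelKernel (μ + k / ρ) (t + y * Complex.I))
        (∫ t in Ioi R, summedKernel ρ μ z (t + y * Complex.I)) := by
    intro y hy
    simp only [← integral_const_mul, pow_mul_hankelKernel]
    refine hasSum_integral_pow_mul (integrableOn_hankelKernel μ R hy)
      (Continuous.aestronglyMeasurable (by fun_prop)) hq0 hz ?_
    filter_upwards [ae_restrict_mem measurableSet_Ioi] with t ht
    exact norm_mul_exp_neg_div_le hρ z (le_of_lt ht) y
  have hvert : HasSum (fun k : ℕ => z ^ k * ∫ y in a..b,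
      hankelKernel (μ + k / ρ) (R + y * Complex.I))
      (∫ y in a..b, summedKernel ρ μ z (R + y * Complex.I)) := by
    simp only [← intervalIntegral.integral_const_mul, pow_mul_hankelKernel]
    simp only [intervalIntegral.integral_of_le hab]
    exact hasSum_integral_pow_mul (intervalIntegrable_hankelKernel μ R a b).1
      (Continuous.aestronglyMeasurable (by fun_prop)) hq0 hz
      (ae_of_all _ fun y => norm_mul_exp_neg_div_le hρ z le_rfl y)
  have h := ((hray b hb).add (hvert.mul_left Complex.I)).sub (hray a ha)
  simpa only [hankelIntegral, mul_add, mul_sub, mul_left_comm (z ^ _) Complex.I] using h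

/-! ### The substitution `t = ρ log(m r)` on a ray. -/

theorem image_mul_log_Ioi {ρ m A : ℝ} (hρ : 0 < ρ) (hm : 0 < m) (hA : 0 < A) :
    (fun r => ρ * Real.log (m * r)) '' Ioi A = Ioi (ρ * Real.log (m * A)) := by
  ext t
  simp only [mem_image, mem_Ioi]
  constructor
  · rintro ⟨r, hr, rfl⟩
    gcongr
  · intro ht
    refine ⟨Real.exp (t / ρ) / m, ?_, ?_⟩
    · rw [lt_div_iff₀ hm, ← Real.log_lt_iff_lt_exp (by positivity), lt_div_iff₀ hρ]
      rwa [mul_comm A m, mul_comm]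
    · rw [mul_div_cancel₀ _ hm.ne', Real.log_exp]
      field_simp

theorem injOn_mul_log_Ioi {ρ m A : ℝ} (hρ : 0 < ρ) (hm : 0 < m) (hA : 0 < A) :
    InjOn (fun r => ρ * Real.log (m * r)) (Ioi A) := by
  intro r hr r' hr' h
  have h1 := Real.log_injOn_pos (mem_Ioi.2 (mul_pos hm (hA.trans hr)))
    (mem_Ioi.2 (mul_pos hm (hA.trans hr'))) (mul_left_cancel₀ hρ.ne' h)
  exact mul_left_cancel₀ hm.ne' h1

theorem hasDerivAt_mul_log {m r : ℝ} (ρ : ℝ) (hm : 0 < m) (hr : 0 < r) :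
    HasDerivAt (fun r => ρ * Real.log (m * r)) (ρ / r) r := by
  have := ((((hasDerivAt_id r).const_mul m).log (mul_pos hm hr).ne').const_mul ρ)
  refine this.congr_deriv ?_
  simp only [id]
  field_simp

theorem integrableOn_comp_mul_log_iff {ρ m A : ℝ} (hρ : 0 < ρ) (hm : 0 < m) (hA : 0 < A)
    (g : ℝ → ℂ) :
    IntegrableOn g (Ioi (ρ * Real.log (m * A))) ↔
      IntegrableOn (fun r : ℝ => (ρ / r : ℂ) * g (ρ * Real.log (m * r))) (Ioi A) := by
  rw [← image_mul_log_Ioi hρ hm hA, integrableOn_image_iff_integrableOn_abs_deriv_smul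
    measurableSet_Ioi (fun r hr => (hasDerivAt_mul_log ρ hm (hA.trans hr)).hasDerivWithinAt)
    (injOn_mul_log_Ioi hρ hm hA)]
  refine integrableOn_congr_fun (fun r hr => ?_) measurableSet_Ioi
  rw [abs_of_pos (div_pos hρ (hA.trans hr)), Complex.real_smul]
  push_cast
  rfl

theorem integral_comp_mul_log {ρ m A : ℝ} (hρ : 0 < ρ) (hm : 0 < m) (hA : 0 < A)
    (g : ℝ → ℂ) :
    ∫ t in Ioi (ρ * Real.log (m * A)), g t =
      ∫ r in Ioi A, (ρ / r : ℂ) * g (ρ * Real.log (m * r)) := by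
  rw [← image_mul_log_Ioi hρ hm hA, integral_image_eq_integral_abs_deriv_smul
    measurableSet_Ioi (fun r hr => (hasDerivAt_mul_log ρ hm (hA.trans hr)).hasDerivWithinAt)
    (injOn_mul_log_Ioi hρ hm hA)]
  refine setIntegral_congr_fun measurableSet_Ioi (fun r hr => ?_)
  rw [abs_of_pos (div_pos hρ (hA.trans hr)), Complex.real_smul]
  push_cast
  rfl

/-! ### The kernels in polar coordinates. -/

theorem norm_mul_exp_argCut (z : ℂ) : (‖z‖ : ℂ) * Complex.exp (argCut z * Complex.I) = z := by
  have h := Complex.norm_mul_exp_arg_mul_I z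
  unfold argCut
  split_ifs
  · exact h
  · push_cast
    rw [add_mul, Complex.exp_add, Complex.exp_two_pi_mul_I, mul_one, h]

/-- The chosen `w` is a logarithm of `(z r e^{iφ})^ρ` with the argument written out explicitly, so
no principal branch intervenes. -/
theorem hankelKernel_polar (ρ : ℝ) (μ : ℂ) (r φ : ℝ) (z : ℂ) :
    hankelKernel μ ((ρ * Real.log (‖z‖ * r) : ℝ) + (ρ * (argCut z + φ) : ℝ) * Complex.I) =
      Complex.exp (zrPow r z ρ * Complex.exp (Complex.I * ρ * φ)) * zrPow r z (ρ * (1 - μ)) *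
        Complex.exp (Complex.I * (ρ * (1 - μ) * φ)) := by
  rw [hankelKernel, zrPow, zrPow, polarPow, polarPow, ← Complex.exp_add, ← Complex.exp_add,
    ← Complex.exp_add]
  push_cast
  congr 1
  rw [add_assoc]
  congr 1
  · congr 1
    ring
  · ring

/-- Here `e^{w/ρ} = z r e^{iφ}`, so `z` cancels from the ratio. -/
theorem mul_exp_neg_div_polar {ρ r : ℝ} (hρ : 0 < ρ) (hr : 0 < r) (φ : ℝ) {z : ℂ}
    (hz : z ≠ 0) :
    z * Complex.exp
      (-((ρ * Real.log (‖z‖ * r) : ℝ) + (ρ * (argCut z + φ) : ℝ) * Complex.I) / ρ) =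
      (r * Complex.exp (Complex.I * φ))⁻¹ := by
  have hz' : 0 < ‖z‖ := norm_pos_iff.2 hz
  have hρ' : (ρ : ℂ) ≠ 0 := by exact_mod_cast hρ.ne'
  have e : -(((ρ * Real.log (‖z‖ * r) : ℝ) : ℂ) + (ρ * (argCut z + φ) : ℝ) * Complex.I) / ρ =
      -(Real.log (‖z‖ * r) : ℝ) + (-(argCut z * Complex.I) + -(Complex.I * φ)) := by
    push_cast
    field_simp
    ring
  have hlog : Complex.exp (Real.log (‖z‖ * r) : ℝ) = ‖z‖ * r := by
    rw [← Complex.ofReal_exp, Real.exp_log (by positivity)]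
    push_cast
    rfl
  have hn : (‖z‖ : ℂ) ≠ 0 := by exact_mod_cast hz'.ne'
  rw [e, Complex.exp_add, Complex.exp_add, Complex.exp_neg, Complex.exp_neg, Complex.exp_neg, hlog]
  nth_rewrite 1 [← norm_mul_exp_argCut z]
  have := Complex.exp_ne_zero (argCut z * Complex.I)
  field_simp

theorem summedKernel_polar {ρ r : ℝ} (hρ : 0 < ρ) (hr : 0 < r) (μ : ℂ) (φ : ℝ) {z : ℂ}
    (hz : z ≠ 0) :
    summedKernel ρ μ z
      ((ρ * Real.log (‖z‖ * r) : ℝ) + (ρ * (argCut z + φ) : ℝ) * Complex.I) =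
      Complex.exp (zrPow r z ρ * Complex.exp (Complex.I * ρ * φ)) * zrPow r z (ρ * (1 - μ)) *
        Complex.exp (Complex.I * (ρ * (1 - μ) * φ)) /
        (1 - (r * Complex.exp (Complex.I * φ))⁻¹) := by
  rw [summedKernel, hankelKernel_polar, mul_exp_neg_div_polar hρ hr φ hz]

theorem exp_mul_I_ne_of_one_lt {r : ℝ} (hr : 1 < r) {u : ℂ} (hu : ‖u‖ = 1) : (r : ℂ) - u ≠ 0 := by
  intro h
  have := congrArg norm (sub_eq_zero.1 h)
  rw [hu, Complex.norm_real, Real.norm_eq_abs, abs_of_pos (by linarith)] at this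
  linarith

/-- The arc kernel is the summed kernel in polar coordinates. -/
theorem arcKernel_eq {ρ r : ℝ} (hρ : 0 < ρ) (hr : 1 < r) (μ : ℂ) (φ : ℝ) {z : ℂ}
    (hz : z ≠ 0) :
    arcKernel ρ μ r φ z = ρ / (2 * Real.pi) * summedKernel ρ μ z
      ((ρ * Real.log (‖z‖ * r) : ℝ) + (ρ * (argCut z + φ) : ℝ) * Complex.I) := by
  rw [summedKernel_polar hρ (by linarith) μ φ hz, arcKernel, chi, mul_add, Complex.exp_add]
  have h0 : (r : ℂ) ≠ 0 := by exact_mod_cast (by linarith : r ≠ 0)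
  have hu : ‖Complex.exp (Complex.I * φ)‖ = 1 := by
    rw [mul_comm]; exact Complex.norm_exp_ofReal_mul_I φ
  have hinv : ‖(Complex.exp (Complex.I * φ))⁻¹‖ = 1 := by rw [norm_inv, hu, inv_one]
  have hd1 := exp_mul_I_ne_of_one_lt hr hu
  have hd2 := exp_mul_I_ne_of_one_lt hr hinv
  have hune := Complex.exp_ne_zero (Complex.I * φ)
  -- The real-looking denominator is a product of conjugate factors, one of which cancels against
  -- the numerator.
  have hden : (r : ℂ) ^ 2 - 2 * r * Complex.cos φ + 1 =
      (r - Complex.exp (Complex.I * φ)) * (r - (Complex.exp (Complex.I * φ))⁻¹) := by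
    rw [Complex.cos, mul_comm (φ : ℂ), neg_mul, mul_comm (φ : ℂ), Complex.exp_neg]
    field_simp
    ring
  have hexp : Complex.exp (Complex.I * ρ * φ) =
      Complex.cos (ρ * φ) + Complex.I * Complex.sin (ρ * φ) := by
    rw [mul_comm Complex.I (Complex.sin _), ← Complex.exp_mul_I]
    congr 1
    ring
  have hfrac : (r : ℂ) * (r - Complex.exp (Complex.I * φ)) /
      (r ^ 2 - 2 * r * Complex.cos φ + 1) = 1 / (1 - (r * Complex.exp (Complex.I * φ))⁻¹) := by
    have e : 1 - (r * Complex.exp (Complex.I * φ))⁻¹ =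
        (r - (Complex.exp (Complex.I * φ))⁻¹) / r := by
      field_simp
    rw [hden, e]
    field_simp
  rw [hexp, mul_add, Complex.exp_add, div_eq_mul_one_div _ (1 - _), ← hfrac]
  ring_nf

theorem zrPow_mul_exp_neg (r : ℝ) (z a : ℂ) :
    zrPow r z a * Complex.exp (-(Complex.I * Real.pi * a)) = zrRotPow r z a := by
  rw [zrPow, zrRotPow, polarPow, polarPow, ← Complex.exp_add]
  push_cast
  congr 1
  ring

theorem ray_denominator_ne_zero {r : ℝ} (hr : 1 < r) (φ : ℝ) :
    (r : ℂ) ^ 2 + 2 * r * Complex.cos φ + 1 ≠ 0 := by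
  have h : (0 : ℝ) < r ^ 2 + 2 * r * Real.cos φ + 1 := by
    nlinarith [Real.neg_one_le_cos φ, sq_pos_of_pos (sub_pos.2 hr)]
  exact_mod_cast h.ne'

theorem eta_neg (ρ : ℝ) (μ : ℂ) (r φ : ℝ) (z : ℂ) : eta ρ μ r (-φ) z = -eta ρ μ r φ z := by
  simp only [eta, Complex.ofReal_neg, mul_neg, Complex.sin_neg]
  ring

/-- At opposite angles the denominators and cosines agree while `eta` changes sign, so the
difference of exponentials collapses to sines. -/
theorem rayKernelGen_neg_eq {r : ℝ} (hr : 1 < r) (ρ : ℝ) (μ : ℂ) (δ : ℝ) (z : ℂ) :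
    rayKernelGen ρ μ r (-δ) δ z = rayKernel ρ μ r δ z := by
  have hD := ray_denominator_ne_zero hr δ
  have hpi : (Real.pi : ℂ) ≠ 0 := by exact_mod_cast Real.pi_ne_zero
  have e1 : zrPow r z ρ * Complex.exp (-(Complex.I * ρ * Real.pi)) = zrRotPow r z ρ := by
    rw [← zrPow_mul_exp_neg]; ring_nf
  have e2 : zrPow r z (ρ * (1 - μ)) * Complex.exp (-(Complex.I * ρ * Real.pi * (1 - μ))) =
      zrRotPow r z (ρ * (1 - μ)) := by
    rw [← zrPow_mul_exp_neg]; ring_nf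
  rw [rayKernelGen, rayKernel, rayTerm, rayTerm, e1, e2, eta_neg]
  simp only [Complex.ofReal_neg, mul_neg, Complex.cos_neg]
  set η := eta ρ μ r δ z
  have hs : Complex.exp (Complex.I * η) * (r + Complex.exp (Complex.I * δ)) -
      Complex.exp (-(Complex.I * η)) * (r + Complex.exp (-(Complex.I * δ))) =
      2 * Complex.I * (r * Complex.sin η + Complex.sin (η + δ)) := by
    have t1 : Complex.exp (Complex.I * η) * Complex.exp (Complex.I * δ) =
        Complex.exp ((η + δ) * Complex.I) := by
      rw [← Complex.exp_add]; ring_nf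
    have t2 : Complex.exp (-(Complex.I * η)) * Complex.exp (-(Complex.I * δ)) =
        Complex.exp (-(η + δ) * Complex.I) := by
      rw [← Complex.exp_add]; ring_nf
    rw [mul_add, mul_add, t1, t2, Complex.sin, Complex.sin, mul_comm Complex.I η,
      ← neg_mul η]
    linear_combination (r * (Complex.exp (η * Complex.I) - Complex.exp (-η * Complex.I)) +
      (Complex.exp ((η + δ) * Complex.I) - Complex.exp (-(η + δ) * Complex.I))) * Complex.I_sq
  set X := Complex.exp (zrRotPow r z ρ * Complex.cos (ρ * δ))
  set D := (r : ℂ) ^ 2 + 2 * r * Complex.cos δ + 1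
  have hnum : X * D * Complex.exp (Complex.I * η) * (r + Complex.exp (Complex.I * δ)) -
      X * D * Complex.exp (-(Complex.I * η)) * (r + Complex.exp (-(Complex.I * δ))) =
      X * D * (2 * Complex.I * (r * Complex.sin η + Complex.sin (η + δ))) := by
    rw [← hs]; ring
  rw [hnum]
  field_simp [Complex.I_ne_zero]

/-- The ray kernel is the difference of the summed kernels on the two rays. -/
theorem rayKernelGen_eq {ρ r : ℝ} (hρ : 0 < ρ) (hr : 1 < r) (μ : ℂ) (φ₁ φ₂ : ℝ) {z : ℂ}
    (hz : z ≠ 0) :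
    rayKernelGen ρ μ r φ₁ φ₂ z = (2 * Real.pi * Complex.I)⁻¹ * (ρ / r *
      summedKernel ρ μ z ((ρ * Real.log (‖z‖ * r) : ℝ) +
        (ρ * (argCut z + (φ₂ - Real.pi)) : ℝ) * Complex.I) - ρ / r *
      summedKernel ρ μ z ((ρ * Real.log (‖z‖ * r) : ℝ) +
        (ρ * (argCut z + (φ₁ - Real.pi)) : ℝ) * Complex.I)) := by
  have h0 : (r : ℂ) ≠ 0 := by exact_mod_cast (by linarith : r ≠ 0)
  -- The shift by `-π` replaces `e^{iφ}` by `-e^{iφ}`, hence the plus signs; `ρ / r` is the Jacobian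
  -- of `t = ρ log(|z| r)`.
  have key : ∀ φ : ℝ, (ρ / r : ℂ) * summedKernel ρ μ z ((ρ * Real.log (‖z‖ * r) : ℝ) +
        (ρ * (argCut z + (φ - Real.pi)) : ℝ) * Complex.I) =
      ρ * (zrPow r z (ρ * (1 - μ)) * Complex.exp (-(Complex.I * ρ * Real.pi * (1 - μ))) *
        (Complex.exp (zrPow r z ρ * Complex.exp (-(Complex.I * ρ * Real.pi)) *
          Complex.cos (ρ * φ)) * Complex.exp (Complex.I * eta ρ μ r φ z) *
          (r + Complex.exp (Complex.I * φ)))) / (r ^ 2 + 2 * r * Complex.cos φ + 1) := by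
    intro φ
    rw [summedKernel_polar hρ (by linarith) μ _ hz, eta]
    have hu : ‖-Complex.exp (Complex.I * φ)‖ = 1 := by
      rw [norm_neg, mul_comm]; exact Complex.norm_exp_ofReal_mul_I φ
    have hinv : ‖(-Complex.exp (Complex.I * φ))⁻¹‖ = 1 := by rw [norm_inv, hu, inv_one]
    have hd1 := exp_mul_I_ne_of_one_lt hr hu
    have hd2 := exp_mul_I_ne_of_one_lt hr hinv
    have hune := Complex.exp_ne_zero (Complex.I * φ)
    have hrot : Complex.exp (Complex.I * (φ - Real.pi : ℝ)) = -Complex.exp (Complex.I * φ) := by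
      push_cast
      rw [mul_sub, Complex.exp_sub, mul_comm Complex.I (Real.pi : ℂ), Complex.exp_pi_mul_I]
      ring
    have hden : (r : ℂ) ^ 2 + 2 * r * Complex.cos φ + 1 =
        (r - -Complex.exp (Complex.I * φ)) * (r - (-Complex.exp (Complex.I * φ))⁻¹) := by
      rw [Complex.cos, mul_comm (φ : ℂ), neg_mul, mul_comm (φ : ℂ), Complex.exp_neg]
      field_simp
      ring
    have hfrac : (r + Complex.exp (Complex.I * φ)) / (r ^ 2 + 2 * r * Complex.cos φ + 1) =
        1 / r * (1 / (1 - (r * -Complex.exp (Complex.I * φ))⁻¹)) := by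
      have e : 1 - (r * -Complex.exp (Complex.I * φ))⁻¹ =
          (r - (-Complex.exp (Complex.I * φ))⁻¹) / r := by
        rw [mul_inv]
        field_simp
      rw [hden, e, ← sub_neg_eq_add (r : ℂ)]
      field_simp
    have hE : Complex.exp (Complex.I * ρ * (φ - Real.pi : ℝ)) =
        Complex.exp (-(Complex.I * ρ * Real.pi)) *
          (Complex.cos (ρ * φ) + Complex.sin (ρ * φ) * Complex.I) := by
      rw [← Complex.exp_mul_I, ← Complex.exp_add]
      push_cast
      congr 1
      ring
    have hF : Complex.exp (Complex.I * (ρ * (1 - μ) * (φ - Real.pi : ℝ))) =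
        Complex.exp (-(Complex.I * ρ * Real.pi * (1 - μ))) *
          Complex.exp (Complex.I * (ρ * (1 - μ) * φ)) := by
      rw [← Complex.exp_add]
      push_cast
      congr 1
      ring
    have hG : Complex.exp (zrPow r z ρ * Complex.exp (Complex.I * ρ * (φ - Real.pi : ℝ))) =
        Complex.exp (zrPow r z ρ * Complex.exp (-(Complex.I * ρ * Real.pi)) *
          Complex.cos (ρ * φ)) *
        Complex.exp (Complex.I * (zrPow r z ρ * Complex.exp (-(Complex.I * ρ * Real.pi)) *
          Complex.sin (ρ * φ))) := by
      rw [hE, ← Complex.exp_add]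
      congr 1
      ring
    rw [hG, hF, hrot, mul_add Complex.I, Complex.exp_add, div_eq_mul_one_div _ (1 - _)]
    linear_combination (-(ρ * (zrPow r z (ρ * (1 - μ)) *
      Complex.exp (-(Complex.I * ρ * Real.pi * (1 - μ))) *
        (Complex.exp (zrPow r z ρ * Complex.exp (-(Complex.I * ρ * Real.pi)) *
          Complex.cos (ρ * φ)) * (Complex.exp (Complex.I * (zrPow r z ρ *
            Complex.exp (-(Complex.I * ρ * Real.pi)) * Complex.sin (ρ * φ))) *
            Complex.exp (Complex.I * (ρ * (1 - μ) * φ))))))) * hfrac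
  rw [key, key, rayKernelGen, rayTerm, rayTerm]
  have hD1 := ray_denominator_ne_zero hr φ₁
  have hD2 := ray_denominator_ne_zero hr φ₂
  set D1 := (r : ℂ) ^ 2 + 2 * r * Complex.cos φ₁ + 1
  set D2 := (r : ℂ) ^ 2 + 2 * r * Complex.cos φ₂ + 1
  have hpi : (Real.pi : ℂ) ≠ 0 := by exact_mod_cast Real.pi_ne_zero
  have hI := Complex.I_ne_zero
  field_simp

/-- At `ρφ = π` the sine in `eta` vanishes, and with it the dependence of `eta` on `r` and `z`. -/
theorem rayKernel_pi_div (ρ : ℝ) (hρ : 0 < ρ) (μ : ℂ) (r : ℝ) (z : ℂ) :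
    rayKernel ρ μ r (Real.pi / ρ) z = rayKernelPi ρ μ r z := by
  have hρ' : (ρ : ℂ) ≠ 0 := by exact_mod_cast hρ.ne'
  have e : (ρ : ℂ) * (Real.pi / ρ : ℝ) = Real.pi := by
    push_cast; field_simp
  have hη : eta ρ μ r (Real.pi / ρ) z = Real.pi * (1 - μ) := by
    rw [eta, e, Complex.sin_pi, mul_right_comm (ρ : ℂ), e]
    ring
  rw [rayKernel, rayKernelPi, hη, e, Complex.cos_pi]
  push_cast
  ring_nf

/-! ### Assembly of the representation. -/

theorem mittagLeffler_representation {ε ρ δ : ℝ} (hε : 0 < ε) (μ : ℂ) {z : ℂ} (hρ : 0 < ρ)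
    (hδρ : δ ≤ Real.pi / ρ) (hz : z ≠ 0)
    (h1 : Real.pi / (2 * ρ) - δ + Real.pi < argCut z)
    (h2 : argCut z < -(Real.pi / (2 * ρ)) + δ + Real.pi) :
    Summable (fun k : ℕ => z ^ k / Complex.Gamma (μ + k / ρ)) ∧
    IntegrableOn (fun r : ℝ => rayKernel ρ μ r δ z) (Ioi (1 + ε)) ∧
    IntervalIntegrable (fun φ : ℝ => arcKernel ρ μ (1 + ε) φ z) volume
      (-δ - Real.pi) (δ - Real.pi) ∧
    mittagLeffler ρ μ z = (∫ r in Ioi (1 + ε), rayKernel ρ μ r δ z) +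
      ∫ φ in (-δ - Real.pi)..(δ - Real.pi), arcKernel ρ μ (1 + ε) φ z := by
  have hm : 0 < ‖z‖ := norm_pos_iff.2 hz
  have hA : 0 < 1 + ε := by linarith
  have hpi := Real.pi_pos
  have hhalf : ρ * (Real.pi / (2 * ρ)) = Real.pi / 2 := by field_simp
  have hδρ' : ρ * δ ≤ Real.pi := by rw [mul_comm]; exact (le_div_iff₀ hρ).1 hδρ
  have h1' := mul_lt_mul_of_pos_left h1 hρ
  have h2' := mul_lt_mul_of_pos_left h2 hρ
  set R := ρ * Real.log (‖z‖ * (1 + ε)) with hR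
  set a := ρ * (argCut z + (-δ - Real.pi)) with ha
  set b := ρ * (argCut z + (δ - Real.pi)) with hb
  -- The inner ends `∓π/2` come directly from the bounds on `arg z`; the outer ends `∓3π/2` also
  -- need `ρδ ≤ π`.
  have ha' : a ∈ Ioo (-(3 * Real.pi / 2)) (-(Real.pi / 2)) := by
    constructor <;> rw [ha] <;> nlinarith
  have hb' : b ∈ Ioo (Real.pi / 2) (3 * Real.pi / 2) := by
    constructor <;> rw [hb] <;> nlinarith
  have hca : Real.cos a < 0 := by
    rw [← Real.cos_neg]
    exact Real.cos_neg_of_pi_div_two_lt_of_lt (by linarith [ha'.2]) (by linarith [ha'.1])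
  have hcb : Real.cos b < 0 :=
    Real.cos_neg_of_pi_div_two_lt_of_lt hb'.1 (by linarith [hb'.2])
  -- With this `R` the left side equals `1 / (1 + ε)`.
  have hq : ‖z‖ * Real.exp (-R / ρ) < 1 := by
    have : -R / ρ = -Real.log (‖z‖ * (1 + ε)) := by rw [hR]; field_simp
    rw [this, Real.exp_neg, Real.exp_log (by positivity), mul_inv, mul_inv_cancel_left₀ hm.ne']
    exact inv_lt_one_of_one_lt₀ (by linarith)
  have hab : a ≤ b := by linarith [ha'.2, hb'.1]
  have hne : (2 * Real.pi * Complex.I : ℂ) ≠ 0 := Complex.two_pi_I_ne_zero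
  have hsum := (hasSum_pow_mul_hankelIntegral hρ μ hq hab hca hcb).mul_left
    (2 * Real.pi * Complex.I)⁻¹
  have hterm : ∀ k : ℕ, (2 * Real.pi * Complex.I)⁻¹ *
      (z ^ k * hankelIntegral (μ + k / ρ) R a b) = z ^ k / Complex.Gamma (μ + k / ρ) := by
    intro k
    rw [hankelIntegral_eq _ R ha' hb', mul_div_assoc', mul_div_assoc', mul_left_comm,
      inv_mul_cancel₀ hne, mul_one]
  simp only [hterm] at hsum
  have ia := (integrableOn_comp_mul_log_iff hρ hm hA _).1
    (integrableOn_summedKernel_ray (R := R) hρ μ hq hca)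
  have ib := (integrableOn_comp_mul_log_iff hρ hm hA _).1
    (integrableOn_summedKernel_ray (R := R) hρ μ hq hcb)
  have hrayfun : ∀ r ∈ Ioi (1 + ε), (2 * Real.pi * Complex.I : ℂ)⁻¹ * (ρ / r *
      summedKernel ρ μ z ((ρ * Real.log (‖z‖ * r) : ℝ) + b * Complex.I) - ρ / r *
      summedKernel ρ μ z ((ρ * Real.log (‖z‖ * r) : ℝ) + a * Complex.I)) =
      rayKernel ρ μ r δ z := fun r hr => by
    have hr1 : 1 < r := by linarith [mem_Ioi.1 hr]
    rw [← rayKernelGen_neg_eq hr1, rayKernelGen_eq hρ hr1 μ _ _ hz]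
  have harc : ∀ φ : ℝ, (ρ / (2 * Real.pi) : ℂ) * summedKernel ρ μ z
      (R + (ρ * argCut z + ρ * φ : ℝ) * Complex.I) = arcKernel ρ μ (1 + ε) φ z := fun φ => by
    rw [arcKernel_eq hρ (by linarith) μ φ hz, mul_add ρ]
  refine ⟨hsum.summable, ?_, ?_, ?_⟩
  · exact IntegrableOn.congr_fun ((ib.sub ia).const_mul _) hrayfun measurableSet_Ioi
  · simp only [← harc]
    exact (continuous_const.mul ((continuous_summedKernel_vertical hρ μ hq).comp
      (by fun_prop : Continuous fun φ : ℝ => ρ * argCut z + ρ * φ))).intervalIntegrable _ _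
  · rw [mittagLeffler, hsum.tsum_eq, integral_comp_mul_log hρ hm hA,
      integral_comp_mul_log hρ hm hA, ← setIntegral_congr_fun measurableSet_Ioi hrayfun,
      integral_const_mul, integral_sub ib ia]
    simp only [← harc]
    -- On the arc `y = ρ arg z + ρφ`: the Jacobian cancels the `ρ` of the prefactor, and the `i` of
    -- the vertical segment that of `2πi`.
    rw [intervalIntegral.integral_const_mul,
      intervalIntegral.integral_comp_add_mul
        (fun y : ℝ => summedKernel ρ μ z (R + y * Complex.I)) hρ.ne', ← mul_add, ← mul_add,
      ← ha, ← hb, Complex.real_smul]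
    have hI := Complex.I_ne_zero
    have hρ' : (ρ : ℂ) ≠ 0 := by exact_mod_cast hρ.ne'
    have hpi' : (Real.pi : ℂ) ≠ 0 := by exact_mod_cast Real.pi_ne_zero
    push_cast
    field_simp
    ring

end MittagLefflerRep

theorem corollary1 (ε : ℝ) (hε : 0 < ε) (μ : ℂ) :
    (∀ (ρ δ : ℝ) (z : ℂ), 1 / 2 < ρ →
      Real.pi / (2 * ρ) < δ → δ ≤ min Real.pi (Real.pi / ρ) → z ≠ 0 →
      Real.pi / (2 * ρ) - δ + Real.pi < MittagLefflerRep.argCut z →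
      MittagLefflerRep.argCut z < -(Real.pi / (2 * ρ)) + δ + Real.pi →
      (∀ r : ℝ, 1 + ε ≤ r →
        MittagLefflerRep.rayKernelGen ρ μ r (-δ) δ z = MittagLefflerRep.rayKernel ρ μ r δ z) ∧
      Summable (fun k : ℕ => z ^ k / Complex.Gamma (μ + k / ρ)) ∧
      MeasureTheory.IntegrableOn (fun r : ℝ => MittagLefflerRep.rayKernel ρ μ r δ z)
        (Set.Ioi (1 + ε)) ∧
      IntervalIntegrable (fun φ : ℝ => MittagLefflerRep.arcKernel ρ μ (1 + ε) φ z)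
        MeasureTheory.volume (-δ - Real.pi) (δ - Real.pi) ∧
      MittagLefflerRep.mittagLeffler ρ μ z =
        (∫ r in Set.Ioi (1 + ε), MittagLefflerRep.rayKernel ρ μ r δ z) +
          ∫ φ in (-δ - Real.pi)..(δ - Real.pi), MittagLefflerRep.arcKernel ρ μ (1 + ε) φ z) ∧
    (∀ (ρ : ℝ) (z : ℂ), 1 ≤ ρ → z ≠ 0 →
      -(Real.pi / (2 * ρ)) + Real.pi < MittagLefflerRep.argCut z →
      MittagLefflerRep.argCut z < Real.pi / (2 * ρ) + Real.pi →
      (∀ r : ℝ, 1 + ε ≤ r →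
        MittagLefflerRep.rayKernel ρ μ r (Real.pi / ρ) z =
          MittagLefflerRep.rayKernelPi ρ μ r z) ∧
      Summable (fun k : ℕ => z ^ k / Complex.Gamma (μ + k / ρ)) ∧
      MeasureTheory.IntegrableOn (fun r : ℝ => MittagLefflerRep.rayKernelPi ρ μ r z)
        (Set.Ioi (1 + ε)) ∧
      IntervalIntegrable (fun φ : ℝ => MittagLefflerRep.arcKernel ρ μ (1 + ε) φ z)
        MeasureTheory.volume (-(Real.pi / ρ) - Real.pi) (Real.pi / ρ - Real.pi) ∧
      MittagLefflerRep.mittagLeffler ρ μ z =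
        (∫ r in Set.Ioi (1 + ε), MittagLefflerRep.rayKernelPi ρ μ r z) +
          ∫ φ in (-(Real.pi / ρ) - Real.pi)..(Real.pi / ρ - Real.pi),
            MittagLefflerRep.arcKernel ρ μ (1 + ε) φ z) := by
  refine ⟨fun ρ δ z hρ hδ1 hδ2 hz h1 h2 => ?_, fun ρ z hρ hz h1 h2 => ?_⟩
  · have hρ0 : 0 < ρ := by linarith
    exact ⟨fun r hr => MittagLefflerRep.rayKernelGen_neg_eq (by linarith) ρ μ δ z,
      MittagLefflerRep.mittagLeffler_representation hε μ hρ0 (hδ2.trans (min_le_right _ _))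
        hz h1 h2⟩
  · have hρ0 : 0 < ρ := by linarith
    have hpi := Real.pi_pos
    -- For `δ = π/ρ` this turns the sector of the first part into that of the second.
    have e : Real.pi / ρ = 2 * (Real.pi / (2 * ρ)) := by field_simp
    have key := MittagLefflerRep.mittagLeffler_representation hε μ (δ := Real.pi / ρ) hρ0
      le_rfl hz (by linarith) (by linarith)
    simp only [MittagLefflerRep.rayKernel_pi_div ρ hρ0] at key
    exact ⟨fun r _ => MittagLefflerRep.rayKernel_pi_div ρ hρ0 μ r z, key⟩
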